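/- Let $H$ be a complex Hilbert space. A *context* of $H$ is a unital abelian von Neumann subalgebra $V$ of $B(H)$. For a projection $P$ on $H$, its *inner daseinisation* $\delta^i(P)_V$ to $V$ is the largest projection in $V$ that is less than or equal to $P$. For a bounded self-adjoint operator $\hat A$ on $H$ with right-continuous spectral family $(\hat E^{\hat A}_\lambda)_{\lambda\in\mathbb R}$, $\hat E^{\hat A}_\lambda=\chi_{(-\infty,\lambda]}(\hat A)$, its *outer daseinisation* to $V$ is $$\delta(\hat A)_V=\int_{\mathbb R}\lambda\, d\big(\delta^i(\hat E^{\hat A}_\lambda)_V\big),$$ where the integral is the limit in operator norm of Riemann–Stieltjes sums. Let $H_1,H_2$ be complex Hilbert spaces, let $\hat A_1\in B(H_1)$ and $\hat A_2\in B(H_2)$ be such that the operator $\hat A_1\oplus\hat A_2$ on $H_1\oplus H_2$ is self-adjoint, let $V_1$ be a context of $H_1$ and $V_2$ a context of $H_2$, and let $V=V_1\oplus V_2=\{a\oplus b : a\in V_1,\ b\in V_2\}$, which is a context of $H_1\oplus H_2$. Then the integrals that define $\delta(\hat A_1)_{V_1}$, $\delta(\hat A_2)_{V_2}$ and $\delta(\hat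 A_1\oplus\hat A_2)_V$ exist, and $$\delta(\hat A_1\oplus\hat A_2)_V=\delta(\hat A_1)_{V_1}\oplus\delta(\hat A_2)_{V_2}.$$ -/

import Mathlib

noncomputable section

/-! ### Contexts -/

/-- A context of the Hilbert space `H`: a unital abelian von Neumann subalgebra of `B(H)`. -/
structure Context (H : Type*) [NormedAddCommGroup H] [InnerProductSpace ℂ H] [CompleteSpace H]
    extends VonNeumannAlgebra H where
  mul_comm_of_mem : ∀ a ∈ toVonNeumannAlgebra, ∀ b ∈ toVonNeumannAlgebra, a * b = b * a

/-! ### Direct sums of operators and of contexts -/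

section DirectSum

variable {H₁ H₂ : Type*}
  [NormedAddCommGroup H₁] [InnerProductSpace ℂ H₁]
  [NormedAddCommGroup H₂] [InnerProductSpace ℂ H₂]

/-- The operator `A₁ ⊕ A₂ : (x, y) ↦ (A₁ x, A₂ y)` on the Hilbert space direct sum `H₁ ⊕ H₂`. -/
def opSum (A₁ : H₁ →L[ℂ] H₁) (A₂ : H₂ →L[ℂ] H₂) :
    WithLp 2 (H₁ × H₂) →L[ℂ] WithLp 2 (H₁ × H₂) :=
  (WithLp.prodContinuousLinearEquiv 2 ℂ H₁ H₂).symm.toContinuousLinearMap ∘L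
    (A₁.prodMap A₂) ∘L (WithLp.prodContinuousLinearEquiv 2 ℂ H₁ H₂).toContinuousLinearMap

theorem opSum_apply (A₁ : H₁ →L[ℂ] H₁) (A₂ : H₂ →L[ℂ] H₂) (x : WithLp 2 (H₁ × H₂)) :
    opSum A₁ A₂ x = WithLp.toLp 2 (A₁ x.fst, A₂ x.snd) := rfl

theorem opSum_mul (A₁ B₁ : H₁ →L[ℂ] H₁) (A₂ B₂ : H₂ →L[ℂ] H₂) :
    opSum A₁ A₂ * opSum B₁ B₂ = opSum (A₁ * B₁) (A₂ * B₂) := rfl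

theorem opSum_add (A₁ B₁ : H₁ →L[ℂ] H₁) (A₂ B₂ : H₂ →L[ℂ] H₂) :
    opSum A₁ A₂ + opSum B₁ B₂ = opSum (A₁ + B₁) (A₂ + B₂) := rfl

theorem opSum_algebraMap (c : ℂ) :
    opSum (algebraMap ℂ (H₁ →L[ℂ] H₁) c) (algebraMap ℂ (H₂ →L[ℂ] H₂) c) =
      algebraMap ℂ (WithLp 2 (H₁ × H₂) →L[ℂ] WithLp 2 (H₁ × H₂)) c := rfl

theorem opSum_injective {A₁ B₁ : H₁ →L[ℂ] H₁} {A₂ B₂ : H₂ →L[ℂ] H₂}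
    (h : opSum A₁ A₂ = opSum B₁ B₂) : A₁ = B₁ ∧ A₂ = B₂ := by
  constructor
  · ext x
    have := congrArg (fun T => (T (WithLp.toLp 2 (x, 0))).fst) h
    simpa [opSum_apply] using this
  · ext x
    have := congrArg (fun T => (T (WithLp.toLp 2 (0, x))).snd) h
    simpa [opSum_apply] using this

variable [CompleteSpace H₁] [CompleteSpace H₂]

theorem star_opSum (A₁ : H₁ →L[ℂ] H₁) (A₂ : H₂ →L[ℂ] H₂) :
    star (opSum A₁ A₂) = opSum (star A₁) (star A₂) := by
  rw [ContinuousLinearMap.star_eq_adjoint, eq_comm, ContinuousLinearMap.eq_adjoint_iff]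
  intro x y
  simp [opSum_apply, WithLp.prod_inner_apply, ContinuousLinearMap.star_eq_adjoint,
    ContinuousLinearMap.adjoint_inner_left]

namespace Context

/-- The set of all `a ⊕ b` with `a ∈ V₁` and `b ∈ V₂`. -/
def sumCarrier (V₁ : Context H₁) (V₂ : Context H₂) :
    Set (WithLp 2 (H₁ × H₂) →L[ℂ] WithLp 2 (H₁ × H₂)) :=
  {T | ∃ a ∈ V₁.toVonNeumannAlgebra, ∃ b ∈ V₂.toVonNeumannAlgebra, T = opSum a b}

theorem sumCarrier_bicommutant (V₁ : Context H₁) (V₂ : Context H₂) :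
    Set.centralizer (Set.centralizer (sumCarrier V₁ V₂)) = sumCarrier V₁ V₂ := by
  apply Set.Subset.antisymm _ Set.subset_centralizer_centralizer
  intro T hT
  rw [Set.mem_centralizer_iff] at hT
  have key : ∀ (c : H₁ →L[ℂ] H₁) (d : H₂ →L[ℂ] H₂),
      c ∈ V₁.toVonNeumannAlgebra.commutant → d ∈ V₂.toVonNeumannAlgebra.commutant →
      opSum c d * T = T * opSum c d := by
    intro c d hc hd
    apply hT
    rw [Set.mem_centralizer_iff]
    rintro _ ⟨a, ha, b, hb, rfl⟩
    rw [opSum_mul, opSum_mul, VonNeumannAlgebra.mem_commutant_iff.1 hc a ha,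
      VonNeumannAlgebra.mem_commutant_iff.1 hd b hb]
  -- the two diagonal blocks of `T`
  let e := WithLp.prodContinuousLinearEquiv 2 ℂ H₁ H₂
  let T₁ : H₁ →L[ℂ] H₁ := ContinuousLinearMap.fst ℂ H₁ H₂ ∘L e.toContinuousLinearMap ∘L T ∘L
    e.symm.toContinuousLinearMap ∘L ContinuousLinearMap.inl ℂ H₁ H₂
  let T₂ : H₂ →L[ℂ] H₂ := ContinuousLinearMap.snd ℂ H₁ H₂ ∘L e.toContinuousLinearMap ∘L T ∘L
    e.symm.toContinuousLinearMap ∘L ContinuousLinearMap.inr ℂ H₁ H₂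
  have h1 : ∀ x, T₁ x = (T (WithLp.toLp 2 (x, 0))).fst := fun _ => rfl
  have h2 : ∀ x, T₂ x = (T (WithLp.toLp 2 (0, x))).snd := fun _ => rfl
  have hTsum : T = opSum T₁ T₂ := by
    have hk := key 1 0 (one_mem _) (zero_mem _)
    ext x
    have hx : x = WithLp.toLp 2 (x.fst, 0) + WithLp.toLp 2 (0, x.snd) := by
      apply (WithLp.equiv 2 (H₁ × H₂)).injective
      ext <;> simp
    have e1 := congrArg (fun S => S (WithLp.toLp 2 (x.fst, 0))) hk
    have e2 := congrArg (fun S => S (WithLp.toLp 2 (0, x.snd))) hk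
    have z : T (WithLp.toLp 2 ((0 : H₁), (0 : H₂))) = 0 := map_zero T
    have e2' : (T (WithLp.toLp 2 (0, x.snd))).fst = 0 :=
      (congrArg (fun w => w.fst) e2).trans (congrArg (fun w => w.fst) z)
    have e1' : (T (WithLp.toLp 2 (x.fst, 0))).snd = 0 :=
      (congrArg (fun w => w.snd) e1).symm
    rw [opSum_apply, h1, h2]
    conv_lhs => rw [hx, map_add]
    apply (WithLp.equiv 2 (H₁ × H₂)).injective
    ext
    · change (T (WithLp.toLp 2 (x.fst, 0))).fst + (T (WithLp.toLp 2 (0, x.snd))).fst = _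
      rw [e2', add_zero]; rfl
    · change (T (WithLp.toLp 2 (x.fst, 0))).snd + (T (WithLp.toLp 2 (0, x.snd))).snd = _
      rw [e1', zero_add]; rfl
  refine ⟨T₁, ?_, T₂, ?_, hTsum⟩
  · rw [← V₁.toVonNeumannAlgebra.commutant_commutant, VonNeumannAlgebra.mem_commutant_iff]
    intro c hc
    have := key c 0 hc (zero_mem _)
    rw [hTsum, opSum_mul, opSum_mul] at this
    exact (opSum_injective this).1
  · rw [← V₂.toVonNeumannAlgebra.commutant_commutant, VonNeumannAlgebra.mem_commutant_iff]
    intro d hd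
    have := key 0 d (zero_mem _) hd
    rw [hTsum, opSum_mul, opSum_mul] at this
    exact (opSum_injective this).2

/-- The context `V₁ ⊕ V₂ = {a ⊕ b | a ∈ V₁, b ∈ V₂}` of `H₁ ⊕ H₂`. -/
def directSum (V₁ : Context H₁) (V₂ : Context H₂) : Context (WithLp 2 (H₁ × H₂)) where
  carrier := sumCarrier V₁ V₂
  mul_mem' := by
    rintro _ _ ⟨a, ha, b, hb, rfl⟩ ⟨c, hc, d, hd, rfl⟩
    exact ⟨a * c, mul_mem ha hc, b * d, mul_mem hb hd, opSum_mul _ _ _ _⟩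
  add_mem' := by
    rintro _ _ ⟨a, ha, b, hb, rfl⟩ ⟨c, hc, d, hd, rfl⟩
    exact ⟨a + c, add_mem ha hc, b + d, add_mem hb hd, opSum_add _ _ _ _⟩
  algebraMap_mem' c :=
    ⟨_, V₁.algebraMap_mem' c, _, V₂.algebraMap_mem' c, (opSum_algebraMap c).symm⟩
  star_mem' := by
    rintro _ ⟨a, ha, b, hb, rfl⟩
    exact ⟨star a, star_mem ha, star b, star_mem hb, star_opSum _ _⟩
  centralizer_centralizer' := sumCarrier_bicommutant V₁ V₂
  mul_comm_of_mem := by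
    rintro _ ⟨a, ha, b, hb, rfl⟩ _ ⟨c, hc, d, hd, rfl⟩
    rw [opSum_mul, opSum_mul, V₁.mul_comm_of_mem a ha c hc, V₂.mul_comm_of_mem b hb d hd]

theorem mem_directSum {V₁ : Context H₁} {V₂ : Context H₂}
    {T : WithLp 2 (H₁ × H₂) →L[ℂ] WithLp 2 (H₁ × H₂)} :
    T ∈ (directSum V₁ V₂).toVonNeumannAlgebra ↔
      ∃ a ∈ V₁.toVonNeumannAlgebra, ∃ b ∈ V₂.toVonNeumannAlgebra, T = opSum a b := Iff.rfl

end Context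

end DirectSum

/-! ### Daseinisation -/

section Daseinisation

variable {H : Type*} [NormedAddCommGroup H] [InnerProductSpace ℂ H] [CompleteSpace H]

/-- The (right-continuous) spectral family `E_r = χ_{(-∞, r]}(A)` of a bounded self-adjoint
operator `A`: the projection onto the kernel of the positive part `(A - r)⁺`. -/
def spectralFamily (A : H →L[ℂ] H) (r : ℝ) : H →L[ℂ] H :=
  (cfc (fun x : ℝ => max (x - r) 0) A).ker.starProjection

/-- The inner daseinisation of a projection `P` to the context `V`: the supremum of all
projections `Q ∈ V` with `Q ≤ P`, that is, the projection onto the closed linear span of their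
ranges. It is the largest projection in `V` below `P`
(see `innerDaseinisation_isGreatest`). -/
def innerDaseinisation (V : Context H) (P : H →L[ℂ] H) : H →L[ℂ] H :=
  (⨆ Q ∈ {Q : H →L[ℂ] H | IsStarProjection Q ∧ Q ∈ V.toVonNeumannAlgebra ∧ Q ≤ P},
    Q.range).topologicalClosure.starProjection

theorem innerDaseinisation_isGreatest (V : Context H) {P : H →L[ℂ] H} (hP : IsStarProjection P) :
    IsGreatest {Q : H →L[ℂ] H | IsStarProjection Q ∧ Q ∈ V.toVonNeumannAlgebra ∧ Q ≤ P}
      (innerDaseinisation V P) := by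
  set S : Set (H →L[ℂ] H) :=
    {Q | IsStarProjection Q ∧ Q ∈ V.toVonNeumannAlgebra ∧ Q ≤ P} with hS
  have hle : ∀ {Q R : H →L[ℂ] H}, IsStarProjection Q → IsStarProjection R →
      (Q ≤ R ↔ Q.range ≤ R.range) := by
    intro Q R hQ hR
    obtain ⟨U, _, rfl⟩ := isStarProjection_iff_eq_starProjection.1 hQ
    obtain ⟨W, _, rfl⟩ := isStarProjection_iff_eq_starProjection.1 hR
    rw [Submodule.starProjection_le_starProjection_iff, Submodule.range_starProjection,
      Submodule.range_starProjection]
  have hI : IsStarProjection (innerDaseinisation V P) := isStarProjection_starProjection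
  have hrange : (innerDaseinisation V P).range = (⨆ Q ∈ S, Q.range).topologicalClosure :=
    Submodule.range_starProjection _
  refine ⟨⟨hI, ?_, ?_⟩, ?_⟩
  · rw [VonNeumannAlgebra.IsStarProjection.mem_iff hI]
    intro y hy
    rw [hrange, Module.End.mem_invtSubmodule]
    have h0 : (⨆ Q ∈ S, Q.range) ≤ (⨆ Q ∈ S, Q.range).comap (y : H →ₗ[ℂ] H) := by
      refine iSup₂_le fun Q hQ => ?_
      refine le_trans ?_ (Submodule.comap_mono (le_iSup₂_of_le Q hQ le_rfl))
      exact (VonNeumannAlgebra.IsStarProjection.mem_iff hQ.1 _).1 hQ.2.1 y hy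
    intro x hx
    exact map_mem_closure y.continuous hx (fun z hz => h0 hz)
  · rw [hle hI hP, hrange]
    obtain ⟨W, _, rfl⟩ := isStarProjection_iff_eq_starProjection.1 hP
    refine Submodule.topologicalClosure_minimal _
      (iSup₂_le fun Q hQ => (hle hQ.1 hP).1 hQ.2.2) ?_
    rw [Submodule.range_starProjection]
    exact Submodule.orthogonal_orthogonal W ▸ Submodule.isClosed_orthogonal Wᗮ
  · intro Q hQ
    rw [hle hQ.1 hI, hrange]
    exact (le_iSup₂_of_le (f := fun (Q : H →L[ℂ] H) (_ : Q ∈ S) => Q.range) Q hQ le_rfl).trans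
      (Submodule.le_topologicalClosure _)

/-- `B = ∫ r dF_r`, the integral over the whole real line of an operator-valued function `F`: `B`
is the limit in norm of the Riemann-Stieltjes sums `∑ sₖ (F(tₖ₊₁) - F(tₖ))`, with
`tₖ ≤ sₖ ≤ tₖ₊₁`, as the mesh of the partition `t₀ ≤ t₁ ≤ ⋯ ≤ tₙ` tends to `0` and the interval
`[t₀, tₙ]` exhausts the line. -/
def IsSpectralIntegral (F : ℝ → H →L[ℂ] H) (B : H →L[ℂ] H) : Prop :=
  ∀ ε > 0, ∃ δ > 0, ∃ R : ℝ, ∀ (n : ℕ) (t s : ℕ → ℝ), t 0 ≤ -R → R ≤ t n →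
    (∀ k < n, t k ≤ s k ∧ s k ≤ t (k + 1) ∧ t (k + 1) - t k ≤ δ) →
    ‖(∑ k ∈ Finset.range n, (s k : ℂ) • (F (t (k + 1)) - F (t k))) - B‖ ≤ ε

open Classical in
/-- The operator `∫ r dF_r`, with the value `0` if the integral does not exist. -/
def spectralIntegral (F : ℝ → H →L[ℂ] H) : H →L[ℂ] H :=
  if h : ∃ B, IsSpectralIntegral F B then h.choose else 0

/-- The inner daseinisations to `V` of the projections in the spectral family of `A`. -/
def daseinisedFamily (V : Context H) (A : H →L[ℂ] H) (r : ℝ) : H →L[ℂ] H :=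
  innerDaseinisation V (spectralFamily A r)

/-- The outer daseinisation `δ(A)_V = ∫ r d(δⁱ(E_r)_V)` of a bounded self-adjoint operator `A`
with spectral family `E` to the context `V`. -/
def outerDaseinisation (V : Context H) (A : H →L[ℂ] H) : H →L[ℂ] H :=
  spectralIntegral (daseinisedFamily V A)

end Daseinisation

end

/-! Every ingredient of the outer daseinisation splits into blocks. The kernel of `(A - r)⁺` does,
because the continuous functional calculus commutes with the star homomorphism `(a, b) ↦ a ⊕ b`
(`cfc_opSum`, `spectralFamily_opSum`). The greatest projection below `P₁ ⊕ P₂` does, because the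
projections of `V₁ ⊕ V₂` are the sums `Q₁ ⊕ Q₂`, ordered blockwise (`innerDaseinisation_directSum`).
Riemann-Stieltjes sums and their norm limits do, because `opSum` is linear and bounded
(`isSpectralIntegral_opSum`).

Existence is separate: the daseinised family is monotone and runs from `0` to `1` on a bounded
interval, and Riemann-Stieltjes sums of such a family are Cauchy as the mesh shrinks
(`norm_stieltjesSum_sub_le`). Uniqueness of the limit then identifies the two sides. -/

/-! ### Riemann-Stieltjes sums of bounded monotone families of projections -/

section SpectralIntegral

variable {H : Type*} [NormedAddCommGroup H] [InnerProductSpace ℂ H]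

/-- Partitions of arbitrarily large intervals into pieces of a prescribed length exist. -/
theorem exists_partition (R : ℝ) {δ : ℝ} (hδ : 0 < δ) :
    ∃ (n : ℕ) (t : ℕ → ℝ), t 0 ≤ -R ∧ R ≤ t n ∧
      ∀ k < n, t k ≤ t k ∧ t k ≤ t (k + 1) ∧ t (k + 1) - t k ≤ δ := by
  obtain ⟨n, hn⟩ := exists_nat_ge (2 * R / δ)
  rw [div_le_iff₀ hδ] at hn
  refine ⟨n, fun k => -R + k * δ, by simp, by linarith, fun k _ => ?_⟩
  push_cast
  exact ⟨le_rfl, by linarith, by linarith⟩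

/-- A single partition fine and long enough for both limits compares them; without such partitions
the condition would be vacuous. -/
theorem IsSpectralIntegral.unique {F : ℝ → H →L[ℂ] H} {B B' : H →L[ℂ] H}
    (h : IsSpectralIntegral F B) (h' : IsSpectralIntegral F B') : B = B' := by
  rw [← sub_eq_zero, ← norm_le_zero_iff]
  refine le_of_forall_pos_le_add fun ε hε => ?_
  obtain ⟨δ, hδ, R, hR⟩ := h (ε / 2) (half_pos hε)
  obtain ⟨δ', hδ', R', hR'⟩ := h' (ε / 2) (half_pos hε)
  obtain ⟨n, t, h₀, hn, ht⟩ := exists_partition (max R R') (lt_min hδ hδ')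
  have e := hR n t t (h₀.trans (neg_le_neg (le_max_left _ _))) ((le_max_left _ _).trans hn)
    fun k hk => ⟨(ht k hk).1, (ht k hk).2.1, (ht k hk).2.2.trans (min_le_left _ _)⟩
  have e' := hR' n t t (h₀.trans (neg_le_neg (le_max_right _ _))) ((le_max_right _ _).trans hn)
    fun k hk => ⟨(ht k hk).1, (ht k hk).2.1, (ht k hk).2.2.trans (min_le_right _ _)⟩
  rw [norm_sub_rev] at e
  linarith [norm_sub_le_norm_sub_add_norm_sub B
    (∑ k ∈ Finset.range n, (t k : ℂ) • (F (t (k + 1)) - F (t k))) B']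

theorem IsSpectralIntegral.spectralIntegral_eq {F : ℝ → H →L[ℂ] H} {B : H →L[ℂ] H}
    (h : IsSpectralIntegral F B) : spectralIntegral F = B := by
  have hex : ∃ B, IsSpectralIntegral F B := ⟨B, h⟩
  rw [spectralIntegral, dif_pos hex]
  exact hex.choose_spec.unique h

variable [CompleteSpace H]

theorem norm_le_of_neg_algebraMap_le_of_le_algebraMap {A : Type*} [CStarAlgebra A]
    [PartialOrder A] [StarOrderedRing A] {a : A} {c : ℝ} (hc : 0 ≤ c) (ha : IsSelfAdjoint a)
    (h₁ : algebraMap ℝ A (-c) ≤ a) (h₂ : a ≤ algebraMap ℝ A c) : ‖a‖ ≤ c := by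
  rw [algebraMap_le_iff_le_spectrum] at h₁
  rw [le_algebraMap_iff_spectrum_le] at h₂
  rw [← cfc_id' ℝ a]
  exact norm_cfc_le hc fun x hx => abs_le.2 ⟨h₁ x hx, h₂ x hx⟩

/-- Comparing term by term with `±C • P i` and summing bounds the element between `-C` and `C`.
Terms with `P i = 0` put no constraint on their coefficient. -/
theorem norm_sum_smul_le_of_sum_eq_one {A ι : Type*} [CStarAlgebra A]
    [PartialOrder A] [StarOrderedRing A] (u : Finset ι) {P : ι → A} {c : ι → ℝ} {C : ℝ}
    (hC : 0 ≤ C) (hP : ∀ i ∈ u, 0 ≤ P i) (hsum : ∑ i ∈ u, P i = 1)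
    (hc : ∀ i ∈ u, P i = 0 ∨ |c i| ≤ C) : ‖∑ i ∈ u, c i • P i‖ ≤ C := by
  apply norm_le_of_neg_algebraMap_le_of_le_algebraMap hC
  · exact isSelfAdjoint_sum _ fun i hi => (IsSelfAdjoint.all _).smul (IsSelfAdjoint.of_nonneg (hP i hi))
  · rw [Algebra.algebraMap_eq_smul_one, ← hsum, Finset.smul_sum]
    refine Finset.sum_le_sum fun i hi => ?_
    rcases hc i hi with h | h
    · simp [h]
    · exact smul_le_smul_of_nonneg_right (abs_le.1 h).1 (hP i hi)
  · rw [Algebra.algebraMap_eq_smul_one, ← hsum, Finset.smul_sum]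
    refine Finset.sum_le_sum fun i hi => ?_
    rcases hc i hi with h | h
    · simp [h]
    · exact smul_le_smul_of_nonneg_right (abs_le.1 h).2 (hP i hi)

/-- The Riemann-Stieltjes sum of `F` for the partition points `t` and the tags `s`. -/
def stieltjesSum (F : ℝ → H →L[ℂ] H) (n : ℕ) (t s : ℕ → ℝ) : H →L[ℂ] H :=
  ∑ k ∈ Finset.range n, (s k : ℂ) • (F (t (k + 1)) - F (t k))

/-- A monotone family of projections that increases from `0` to `1` on `[-R, R]`. -/
structure IsBoundedResolution (F : ℝ → H →L[ℂ] H) (R : ℝ) : Prop where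
  isStarProjection : ∀ r, IsStarProjection (F r)
  mono : Monotone F
  eq_zero : ∀ r ≤ -R, F r = 0
  eq_one : ∀ r, R ≤ r → F r = 1

namespace IsBoundedResolution

variable {F : ℝ → H →L[ℂ] H} {R : ℝ}

theorem mul_eq_left (hF : IsBoundedResolution F R) {a b : ℝ} (h : a ≤ b) : F a * F b = F a :=
  ((hF.isStarProjection a).le_iff_mul_eq_left (hF.isStarProjection b)).1 (hF.mono h)

theorem mul_eq_right (hF : IsBoundedResolution F R) {a b : ℝ} (h : a ≤ b) : F b * F a = F a :=
  ((hF.isStarProjection a).le_iff_mul_eq_right (hF.isStarProjection b)).1 (hF.mono h)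

theorem commute (hF : IsBoundedResolution F R) (a b : ℝ) : Commute (F a) (F b) := by
  rcases le_total a b with h | h
  · exact (hF.mul_eq_left h).trans (hF.mul_eq_right h).symm
  · exact (hF.mul_eq_right h).trans (hF.mul_eq_left h).symm

theorem sub_mul_sub_nonneg (hF : IsBoundedResolution F R) {a b c d : ℝ} (hab : a ≤ b)
    (hcd : c ≤ d) : 0 ≤ (F b - F a) * (F d - F c) := by
  refine Commute.mul_nonneg (sub_nonneg.2 (hF.mono hab)) (sub_nonneg.2 (hF.mono hcd)) ?_
  exact ((hF.commute _ _).sub_right (hF.commute _ _)).sub_left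
    ((hF.commute _ _).sub_right (hF.commute _ _))

/-- Increments over non-overlapping intervals are orthogonal: each product in the expansion
collapses to its smaller factor, and these cancel. -/
theorem sub_mul_sub_eq_zero (hF : IsBoundedResolution F R) {a b c d : ℝ} (hab : a ≤ b)
    (hbc : b ≤ c) (hcd : c ≤ d) : (F b - F a) * (F d - F c) = 0 := by
  rw [sub_mul, mul_sub, mul_sub, hF.mul_eq_left hbc, hF.mul_eq_left (hbc.trans hcd),
    hF.mul_eq_left (hab.trans hbc), hF.mul_eq_left (hab.trans (hbc.trans hcd))]
  simp

theorem sub_mul_sub_eq_zero' (hF : IsBoundedResolution F R) {a b c d : ℝ} (hab : a ≤ b)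
    (hda : d ≤ a) (hcd : c ≤ d) : (F b - F a) * (F d - F c) = 0 := by
  rw [sub_mul, mul_sub, mul_sub, hF.mul_eq_right hda, hF.mul_eq_right (hda.trans hab),
    hF.mul_eq_right (hcd.trans hda), hF.mul_eq_right (hcd.trans (hda.trans hab))]
  simp

theorem sum_sub_eq_one (hF : IsBoundedResolution F R) {n : ℕ} {t : ℕ → ℝ} (h₀ : t 0 ≤ -R)
    (hn : R ≤ t n) : ∑ k ∈ Finset.range n, (F (t (k + 1)) - F (t k)) = 1 := by
  rw [Finset.sum_range_sub (fun k => F (t k)), hF.eq_one _ hn, hF.eq_zero _ h₀, sub_zero]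

/-- Any two Riemann-Stieltjes sums over fine partitions are close. -/
theorem norm_stieltjesSum_sub_le (hF : IsBoundedResolution F R) {n m : ℕ} {t s t' s' : ℕ → ℝ}
    {δ δ' : ℝ} (hδ : 0 ≤ δ) (hδ' : 0 ≤ δ')
    (h₀ : t 0 ≤ -R) (hn : R ≤ t n)
    (ht : ∀ k < n, t k ≤ s k ∧ s k ≤ t (k + 1) ∧ t (k + 1) - t k ≤ δ)
    (h₀' : t' 0 ≤ -R) (hm : R ≤ t' m)
    (ht' : ∀ k < m, t' k ≤ s' k ∧ s' k ≤ t' (k + 1) ∧ t' (k + 1) - t' k ≤ δ') :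
    ‖stieltjesSum F n t s - stieltjesSum F m t' s'‖ ≤ δ + δ' := by
  set E : ℕ → H →L[ℂ] H := fun k => F (t (k + 1)) - F (t k) with hE
  set E' : ℕ → H →L[ℂ] H := fun k => F (t' (k + 1)) - F (t' k) with hE'
  have hsE : ∑ k ∈ Finset.range n, E k = 1 := hF.sum_sub_eq_one h₀ hn
  have hsE' : ∑ k ∈ Finset.range m, E' k = 1 := hF.sum_sub_eq_one h₀' hm
  -- The products `E j * E' k` play the role of a common refinement: inserting `1 = ∑ E' k` or `1 =
  -- ∑ E j` writes both sums over the same positive partition of unity.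
  have e₁ : stieltjesSum F n t s =
      ∑ p ∈ Finset.range n ×ˢ Finset.range m, s p.1 • (E p.1 * E' p.2) := by
    rw [Finset.sum_product]
    refine Finset.sum_congr rfl fun k _ => ?_
    dsimp only
    rw [← Finset.smul_sum, ← Finset.mul_sum, hsE', mul_one, Complex.coe_smul]
  have e₂ : stieltjesSum F m t' s' =
      ∑ p ∈ Finset.range n ×ˢ Finset.range m, s' p.2 • (E p.1 * E' p.2) := by
    rw [Finset.sum_product_right]
    refine Finset.sum_congr rfl fun k _ => ?_
    dsimp only
    rw [← Finset.smul_sum, ← Finset.sum_mul, hsE, one_mul, Complex.coe_smul]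
  rw [e₁, e₂, ← Finset.sum_sub_distrib]
  simp_rw [← sub_smul]
  refine norm_sum_smul_le_of_sum_eq_one _ (add_nonneg hδ hδ') ?_ ?_ ?_
  · rintro ⟨j, k⟩ hp
    rw [Finset.mem_product, Finset.mem_range, Finset.mem_range] at hp
    obtain ⟨a₁, a₂, -⟩ := ht j hp.1
    obtain ⟨b₁, b₂, -⟩ := ht' k hp.2
    exact hF.sub_mul_sub_nonneg (a₁.trans a₂) (b₁.trans b₂)
  · rw [Finset.sum_product]
    simp_rw [← Finset.mul_sum, hsE', mul_one]
    exact hsE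
  · rintro ⟨j, k⟩ hp
    rw [Finset.mem_product, Finset.mem_range, Finset.mem_range] at hp
    obtain ⟨a₁, a₂, a₃⟩ := ht j hp.1
    obtain ⟨b₁, b₂, b₃⟩ := ht' k hp.2
    -- Either the two intervals do not overlap and the product vanishes, or they meet and their tags
    -- differ by at most `δ + δ'`.
    rcases le_or_gt (t (j + 1)) (t' k) with h | h
    · exact .inl (hF.sub_mul_sub_eq_zero (a₁.trans a₂) h (b₁.trans b₂))
    rcases le_or_gt (t' (k + 1)) (t j) with h' | h'
    · exact .inl (hF.sub_mul_sub_eq_zero' (a₁.trans a₂) h' (b₁.trans b₂))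
    refine .inr (abs_le.2 ⟨?_, ?_⟩) <;> dsimp only at * <;> linarith

end IsBoundedResolution

theorem IsBoundedResolution.exists_isSpectralIntegral {F : ℝ → H →L[ℂ] H} {R : ℝ}
    (hF : IsBoundedResolution F R) : ∃ B, IsSpectralIntegral F B := by
  have hpos : ∀ m : ℕ, (0 : ℝ) < 1 / ((m : ℝ) + 1) := fun m => Nat.one_div_pos_of_nat
  choose n t h₀ hn ht using fun m : ℕ => exists_partition R (hpos m)
  set S : ℕ → H →L[ℂ] H := fun m => stieltjesSum F (n m) (t m) (t m) with hS
  have hlim : Filter.Tendsto (fun m : ℕ => 1 / ((m : ℝ) + 1)) Filter.atTop (nhds 0) :=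
    tendsto_one_div_add_atTop_nhds_zero_nat
  have hcauchy : CauchySeq S := by
    refine cauchySeq_of_le_tendsto_0 (fun N : ℕ => 1 / ((N : ℝ) + 1) + 1 / ((N : ℝ) + 1)) ?_
      (by simpa using hlim.add hlim)
    intro m m' N hm hm'
    rw [dist_eq_norm]
    refine (hF.norm_stieltjesSum_sub_le (hpos m).le (hpos m').le (h₀ m) (hn m) (ht m) (h₀ m')
      (hn m') (ht m')).trans (add_le_add ?_ ?_) <;>
    exact Nat.one_div_le_one_div ‹_›
  obtain ⟨B, hB⟩ := cauchySeq_tendsto_of_complete hcauchy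
  -- Mesh `ε` suffices for error `ε`: the distance to the `m`-th sum is at most `ε + 1 / (m + 1)`,
  -- and `m` tends to infinity.
  refine ⟨B, fun ε hε => ⟨ε, hε, R, fun k u s hu₀ hu hus => ?_⟩⟩
  refine le_of_tendsto_of_tendsto (hB.const_sub (stieltjesSum F k u s)).norm
    (by simpa only [add_zero] using hlim.const_add ε) (Filter.Eventually.of_forall fun m => ?_)
  exact hF.norm_stieltjesSum_sub_le hε.le (hpos m).le hu₀ hu hus (h₀ m) (hn m) (ht m)

end SpectralIntegral

/-! ### Spectral families and their daseinisations -/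

section SpectralFamily

variable {H : Type*} [NormedAddCommGroup H] [InnerProductSpace ℂ H] [CompleteSpace H]

theorem isStarProjection_spectralFamily (A : H →L[ℂ] H) (r : ℝ) :
    IsStarProjection (spectralFamily A r) := isStarProjection_starProjection

theorem monotone_spectralFamily (A : H →L[ℂ] H) : Monotone (spectralFamily A) := by
  intro r r' hr
  rcases hr.eq_or_lt with rfl | hlt
  · exact le_rfl
  refine Submodule.starProjection_le_starProjection_iff.2 ?_
  have hpos : ∀ x : ℝ, 0 < max (x - r') 0 + (r' - r) := fun x =>
    add_pos_of_nonneg_of_pos (le_max_right _ _) (sub_pos.2 hlt)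
  -- The quotient `(x - r')⁺ / (x - r)⁺`, with a denominator that equals `x - r` for `x ≥ r'` and
  -- stays positive elsewhere. The factorization gives the inclusion of kernels.
  have hg : Continuous fun x : ℝ => max (x - r') 0 / (max (x - r') 0 + (r' - r)) :=
    Continuous.div (by fun_prop) (by fun_prop) fun x => (hpos x).ne'
  have hfac : cfc (fun x : ℝ => max (x - r') 0) A =
      cfc (fun x : ℝ => max (x - r') 0 / (max (x - r') 0 + (r' - r))) A *
        cfc (fun x : ℝ => max (x - r) 0) A := by
    rw [← cfc_mul _ _ A hg.continuousOn]
    congr 1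
    funext x
    rw [div_mul_eq_mul_div, eq_div_iff (hpos x).ne']
    rcases le_total x r' with h | h
    · simp [h]
    · rw [max_eq_left (sub_nonneg.2 h), max_eq_left (sub_nonneg.2 (hr.trans h))]
      ring
  intro x hx
  rw [LinearMap.mem_ker] at hx ⊢
  rw [hfac]
  exact (congrArg (fun y => (cfc _ A : H →L[ℂ] H) y) hx).trans (map_zero _)

theorem spectralFamily_eq_one {A : H →L[ℂ] H} {r : ℝ}
    (h : ∀ x ∈ spectrum ℝ A, x ≤ r) : spectralFamily A r = 1 := by
  have h0 : cfc (fun x : ℝ => max (x - r) 0) A = 0 := by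
    rw [cfc_congr (g := fun _ => 0) fun x hx => max_eq_right (sub_nonpos.2 (h x hx))]
    simp
  simp [spectralFamily, h0, Submodule.starProjection_top']

theorem spectralFamily_eq_zero {A : H →L[ℂ] H} (hA : IsSelfAdjoint A) {r : ℝ}
    (h : ∀ x ∈ spectrum ℝ A, r < x) : spectralFamily A r = 0 := by
  have hu : IsUnit (cfc (fun x : ℝ => max (x - r) 0) A) := by
    rw [isUnit_cfc_iff _ A]
    exact fun x hx => (lt_max_of_lt_left (sub_pos.2 (h x hx))).ne'
  have hker : (cfc (fun x : ℝ => max (x - r) 0) A).ker = ⊥ := by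
    obtain ⟨u, hu⟩ := hu
    rw [← hu]
    refine (Submodule.eq_bot_iff _).2 fun x hx => ?_
    have : (↑u⁻¹ * ↑u : H →L[ℂ] H) x = 0 := by
      change (↑u⁻¹ : H →L[ℂ] H) ((↑u : H →L[ℂ] H) x) = 0
      rw [show (↑u : H →L[ℂ] H) x = 0 from hx, map_zero]
    simpa using this
  rw [spectralFamily]
  simp only [hker, Submodule.starProjection_bot]

/-- Maximality of the inner daseinisation transfers monotonicity and the value `1`, since `1 ∈ V`.
The `+ 1` puts the spectrum strictly above the left endpoint, as invertibility of `(A - r)⁺`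
requires. -/
theorem isBoundedResolution_daseinisedFamily (V : Context H) {A : H →L[ℂ] H}
    (hA : IsSelfAdjoint A) :
    IsBoundedResolution (daseinisedFamily V A) (‖A‖ * ‖(1 : H →L[ℂ] H)‖ + 1) := by
  have hspec : ∀ x ∈ spectrum ℝ A, |x| ≤ ‖A‖ * ‖(1 : H →L[ℂ] H)‖ := fun x hx =>
    spectrum.norm_le_norm_mul_of_mem hx
  have hgr : ∀ r, IsGreatest _ (daseinisedFamily V A r) := fun r =>
    innerDaseinisation_isGreatest V (isStarProjection_spectralFamily A r)
  refine ⟨fun r => (hgr r).1.1, fun r r' h => (hgr r').2 ?_, fun r hr => ?_, fun r hr => ?_⟩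
  · exact ⟨(hgr r).1.1, (hgr r).1.2.1, (hgr r).1.2.2.trans (monotone_spectralFamily A h)⟩
  · have hle := (hgr r).1.2.2
    rw [spectralFamily_eq_zero hA fun x hx => by linarith [(abs_le.1 (hspec x hx)).1]] at hle
    exact hle.antisymm (hgr r).1.1.nonneg
  · refine (hgr r).1.1.le_one.antisymm ((hgr r).2 ⟨.one _, one_mem _, ?_⟩)
    rw [spectralFamily_eq_one fun x hx => by linarith [(abs_le.1 (hspec x hx)).2]]

theorem isSpectralIntegral_outerDaseinisation (V : Context H) {A : H →L[ℂ] H}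
    (hA : IsSelfAdjoint A) :
    IsSpectralIntegral (daseinisedFamily V A) (outerDaseinisation V A) := by
  obtain ⟨B, hB⟩ := (isBoundedResolution_daseinisedFamily V hA).exists_isSpectralIntegral
  rwa [outerDaseinisation, hB.spectralIntegral_eq]

end SpectralFamily

/-! ### Compatibility with direct sums -/

section DirectSum

variable {H₁ H₂ : Type*}
  [NormedAddCommGroup H₁] [InnerProductSpace ℂ H₁]
  [NormedAddCommGroup H₂] [InnerProductSpace ℂ H₂]

theorem continuous_opSum :
    Continuous fun p : (H₁ →L[ℂ] H₁) × (H₂ →L[ℂ] H₂) => opSum p.1 p.2 := by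
  have : Continuous fun p : (H₁ →L[ℂ] H₁) × (H₂ →L[ℂ] H₂) => p.1.prodMap p.2 :=
    (ContinuousLinearMap.prodMapL ℂ H₁ H₁ H₂ H₂).continuous
  exact continuous_const.clm_comp (this.clm_comp continuous_const)

theorem norm_opSum_le (A₁ : H₁ →L[ℂ] H₁) (A₂ : H₂ →L[ℂ] H₂) :
    ‖opSum A₁ A₂‖ ≤ max ‖A₁‖ ‖A₂‖ := by
  have h0 : 0 ≤ max ‖A₁‖ ‖A₂‖ := le_max_of_le_left (norm_nonneg _)
  refine ContinuousLinearMap.opNorm_le_bound _ h0 fun x => ?_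
  refine le_of_sq_le_sq ?_ (by positivity)
  rw [mul_pow, opSum_apply, WithLp.prod_norm_sq_eq_of_L2, WithLp.prod_norm_sq_eq_of_L2, mul_add,
    ← mul_pow, ← mul_pow]
  refine add_le_add (pow_le_pow_left₀ (norm_nonneg _) ?_ 2)
    (pow_le_pow_left₀ (norm_nonneg _) ?_ 2)
  · exact A₁.le_of_opNorm_le (le_max_left _ _) x.fst
  · exact A₂.le_of_opNorm_le (le_max_right _ _) x.snd

variable [CompleteSpace H₁] [CompleteSpace H₂]

theorem isSelfAdjoint_opSum_iff {A₁ : H₁ →L[ℂ] H₁} {A₂ : H₂ →L[ℂ] H₂} :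
    IsSelfAdjoint (opSum A₁ A₂) ↔ IsSelfAdjoint A₁ ∧ IsSelfAdjoint A₂ := by
  refine ⟨fun h => opSum_injective ((star_opSum A₁ A₂).symm.trans h), fun h => ?_⟩
  rw [IsSelfAdjoint, star_opSum, h.1.star_eq, h.2.star_eq]

theorem isStarProjection_opSum_iff {P₁ : H₁ →L[ℂ] H₁} {P₂ : H₂ →L[ℂ] H₂} :
    IsStarProjection (opSum P₁ P₂) ↔ IsStarProjection P₁ ∧ IsStarProjection P₂ := by
  constructor
  · intro h
    have hs := isSelfAdjoint_opSum_iff.1 h.isSelfAdjoint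
    have hi := opSum_injective ((opSum_mul P₁ P₁ P₂ P₂).symm.trans h.isIdempotentElem)
    exact ⟨⟨hi.1, hs.1⟩, ⟨hi.2, hs.2⟩⟩
  · rintro ⟨h₁, h₂⟩
    refine ⟨?_, isSelfAdjoint_opSum_iff.2 ⟨h₁.isSelfAdjoint, h₂.isSelfAdjoint⟩⟩
    rw [IsIdempotentElem, opSum_mul, h₁.isIdempotentElem.eq, h₂.isIdempotentElem.eq]

theorem opSum_le_opSum_iff {P₁ Q₁ : H₁ →L[ℂ] H₁} {P₂ Q₂ : H₂ →L[ℂ] H₂}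
    (hP₁ : IsStarProjection P₁) (hP₂ : IsStarProjection P₂)
    (hQ₁ : IsStarProjection Q₁) (hQ₂ : IsStarProjection Q₂) :
    opSum P₁ P₂ ≤ opSum Q₁ Q₂ ↔ P₁ ≤ Q₁ ∧ P₂ ≤ Q₂ := by
  rw [(isStarProjection_opSum_iff.2 ⟨hP₁, hP₂⟩).le_iff_mul_eq_left
    (isStarProjection_opSum_iff.2 ⟨hQ₁, hQ₂⟩), hP₁.le_iff_mul_eq_left hQ₁,
    hP₂.le_iff_mul_eq_left hQ₂, opSum_mul]
  exact ⟨fun h => opSum_injective h, fun h => by rw [h.1, h.2]⟩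

/-- Each competitor in `V₁ ⊕ V₂` is block diagonal, so it is bounded by maximality in each block. -/
theorem innerDaseinisation_directSum (V₁ : Context H₁) (V₂ : Context H₂)
    {P₁ : H₁ →L[ℂ] H₁} {P₂ : H₂ →L[ℂ] H₂}
    (hP₁ : IsStarProjection P₁) (hP₂ : IsStarProjection P₂) :
    innerDaseinisation (V₁.directSum V₂) (opSum P₁ P₂) =
      opSum (innerDaseinisation V₁ P₁) (innerDaseinisation V₂ P₂) := by
  have g₁ := innerDaseinisation_isGreatest V₁ hP₁
  have g₂ := innerDaseinisation_isGreatest V₂ hP₂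
  refine (innerDaseinisation_isGreatest (V₁.directSum V₂)
    (isStarProjection_opSum_iff.2 ⟨hP₁, hP₂⟩)).unique ⟨⟨?_, ?_, ?_⟩, ?_⟩
  · exact isStarProjection_opSum_iff.2 ⟨g₁.1.1, g₂.1.1⟩
  · exact Context.mem_directSum.2 ⟨_, g₁.1.2.1, _, g₂.1.2.1, rfl⟩
  · exact (opSum_le_opSum_iff g₁.1.1 g₂.1.1 hP₁ hP₂).2 ⟨g₁.1.2.2, g₂.1.2.2⟩
  · rintro _ ⟨hQ, ⟨a, ha, b, hb, rfl⟩, hle⟩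
    obtain ⟨hqa, hqb⟩ := isStarProjection_opSum_iff.1 hQ
    obtain ⟨hla, hlb⟩ := (opSum_le_opSum_iff hqa hqb hP₁ hP₂).1 hle
    exact (opSum_le_opSum_iff hqa hqb g₁.1.1 g₂.1.1).2
      ⟨g₁.2 ⟨hqa, ha, hla⟩, g₂.2 ⟨hqb, hb, hlb⟩⟩

/-- The direct sum of operators as a homomorphism of star algebras. -/
def opSumStarAlgHom :
    (H₁ →L[ℂ] H₁) × (H₂ →L[ℂ] H₂) →⋆ₐ[ℂ]
      (WithLp 2 (H₁ × H₂) →L[ℂ] WithLp 2 (H₁ × H₂)) where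
  toFun p := opSum p.1 p.2
  map_one' := rfl
  map_mul' _ _ := rfl
  map_zero' := rfl
  map_add' _ _ := rfl
  commutes' c := opSum_algebraMap c
  map_star' p := (star_opSum p.1 p.2).symm

theorem CStarAlgebra.continuousFunctionalCalculus_isSelfAdjoint (A : Type*) [CStarAlgebra A] :
    ContinuousFunctionalCalculus ℝ A IsSelfAdjoint := inferInstance

theorem CStarAlgebra.continuousFunctionalCalculus_prod (A B : Type*) [CStarAlgebra A] [CStarAlgebra B] :
    ContinuousFunctionalCalculus ℝ (A × B) IsSelfAdjoint :=
  CStarAlgebra.continuousFunctionalCalculus_isSelfAdjoint (A × B)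

/-- A continuous star homomorphism commutes with the functional calculus, which acts componentwise
on the product algebra. -/
theorem cfc_opSum {A₁ : H₁ →L[ℂ] H₁} {A₂ : H₂ →L[ℂ] H₂} (h₁ : IsSelfAdjoint A₁)
    (h₂ : IsSelfAdjoint A₂) {f : ℝ → ℝ} (hf : Continuous f) :
    cfc f (opSum A₁ A₂) = opSum (cfc f A₁) (cfc f A₂) := by
  have hp : IsSelfAdjoint ((A₁, A₂) : (H₁ →L[ℂ] H₁) × (H₂ →L[ℂ] H₂)) :=
    Prod.ext h₁ h₂
  have := CStarAlgebra.continuousFunctionalCalculus_prod (H₁ →L[ℂ] H₁) (H₂ →L[ℂ] H₂)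
  have h := opSumStarAlgHom.map_cfc (S := ℂ) f (A₁, A₂) hf.continuousOn continuous_opSum hp
    (isSelfAdjoint_opSum_iff.2 ⟨h₁, h₂⟩)
  rw [cfc_map_prod (S := ℂ) f A₁ A₂ hf.continuousOn hp h₁ h₂] at h
  exact h.symm

theorem starProjection_ker_opSum (T₁ : H₁ →L[ℂ] H₁) (T₂ : H₂ →L[ℂ] H₂) :
    (opSum T₁ T₂).ker.starProjection = opSum T₁.ker.starProjection T₂.ker.starProjection := by
  refine ContinuousLinearMap.ext fun x => ?_
  have hmem : ∀ w, w ∈ (opSum T₁ T₂).ker ↔ w.fst ∈ T₁.ker ∧ w.snd ∈ T₂.ker := fun w =>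
    ⟨fun h => ⟨congrArg WithLp.fst (show opSum T₁ T₂ w = 0 from h),
      congrArg WithLp.snd (show opSum T₁ T₂ w = 0 from h)⟩,
      fun h => show opSum T₁ T₂ w = 0 by
        rw [opSum_apply, show T₁ w.fst = 0 from h.1, show T₂ w.snd = 0 from h.2]; rfl⟩
  -- Membership in the kernel and orthogonality of the residual characterise the projection; both
  -- can be checked blockwise.
  apply Submodule.eq_starProjection_of_mem_of_inner_eq_zero
  · exact (hmem _).2 ⟨Submodule.starProjection_apply_mem _ _,
      Submodule.starProjection_apply_mem _ _⟩
  · intro w hw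
    rw [WithLp.prod_inner_apply]
    refine (congrArg₂ (· + ·)
      (Submodule.starProjection_inner_eq_zero x.fst w.fst ((hmem w).1 hw).1)
      (Submodule.starProjection_inner_eq_zero x.snd w.snd ((hmem w).1 hw).2)).trans ?_
    simp

theorem spectralFamily_opSum {A₁ : H₁ →L[ℂ] H₁} {A₂ : H₂ →L[ℂ] H₂} (h₁ : IsSelfAdjoint A₁)
    (h₂ : IsSelfAdjoint A₂) (r : ℝ) :
    spectralFamily (opSum A₁ A₂) r = opSum (spectralFamily A₁ r) (spectralFamily A₂ r) := by
  simp only [spectralFamily]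
  rw [← starProjection_ker_opSum]
  simp only [cfc_opSum h₁ h₂ (f := fun x : ℝ => max (x - r) 0) (by fun_prop)]

theorem isSpectralIntegral_opSum {F₁ : ℝ → H₁ →L[ℂ] H₁} {F₂ : ℝ → H₂ →L[ℂ] H₂}
    {B₁ : H₁ →L[ℂ] H₁} {B₂ : H₂ →L[ℂ] H₂} (h₁ : IsSpectralIntegral F₁ B₁)
    (h₂ : IsSpectralIntegral F₂ B₂) :
    IsSpectralIntegral (fun r => opSum (F₁ r) (F₂ r)) (opSum B₁ B₂) := by
  intro ε hε
  obtain ⟨δ, hδ, R, hR⟩ := h₁ ε hε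
  obtain ⟨δ', hδ', R', hR'⟩ := h₂ ε hε
  refine ⟨min δ δ', lt_min hδ hδ', max R R', fun n t s h₀ hn ht => ?_⟩
  have e := hR n t s (h₀.trans (neg_le_neg (le_max_left _ _))) ((le_max_left _ _).trans hn)
    fun k hk => ⟨(ht k hk).1, (ht k hk).2.1, (ht k hk).2.2.trans (min_le_left _ _)⟩
  have e' := hR' n t s (h₀.trans (neg_le_neg (le_max_right _ _))) ((le_max_right _ _).trans hn)
    fun k hk => ⟨(ht k hk).1, (ht k hk).2.1, (ht k hk).2.2.trans (min_le_right _ _)⟩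
  -- The norm of a block sum is at most the maximum of the block norms, so `ε` need not be halved.
  refine le_trans (le_of_eq ?_) ((norm_opSum_le _ _).trans (max_le e e'))
  congr 1
  have hsum := map_sum (opSumStarAlgHom (H₁ := H₁) (H₂ := H₂))
    (fun k => (s k : ℂ) • ((F₁ (t (k + 1)), F₂ (t (k + 1))) - (F₁ (t k), F₂ (t k))))
    (Finset.range n)
  simp only [map_smul, map_sub] at hsum
  have hpair : ∑ k ∈ Finset.range n,
      (s k : ℂ) • ((F₁ (t (k + 1)), F₂ (t (k + 1))) - (F₁ (t k), F₂ (t k))) =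
      (∑ k ∈ Finset.range n, (s k : ℂ) • (F₁ (t (k + 1)) - F₁ (t k)),
        ∑ k ∈ Finset.range n, (s k : ℂ) • (F₂ (t (k + 1)) - F₂ (t k))) := by
    ext1 <;> simp [Prod.fst_sum, Prod.snd_sum]
  rw [hpair] at hsum
  exact congrArg (· - opSum B₁ B₂) hsum.symm

end DirectSum

theorem mainTheorem1 {H₁ H₂ : Type*}
    [NormedAddCommGroup H₁] [InnerProductSpace ℂ H₁] [CompleteSpace H₁]
    [NormedAddCommGroup H₂] [InnerProductSpace ℂ H₂] [CompleteSpace H₂]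
    (A₁ : H₁ →L[ℂ] H₁) (A₂ : H₂ →L[ℂ] H₂) (hA : IsSelfAdjoint (opSum A₁ A₂))
    (V₁ : Context H₁) (V₂ : Context H₂) :
    (IsSpectralIntegral (daseinisedFamily V₁ A₁) (outerDaseinisation V₁ A₁) ∧
      IsSpectralIntegral (daseinisedFamily V₂ A₂) (outerDaseinisation V₂ A₂) ∧
      IsSpectralIntegral (daseinisedFamily (V₁.directSum V₂) (opSum A₁ A₂))
        (outerDaseinisation (V₁.directSum V₂) (opSum A₁ A₂))) ∧
    outerDaseinisation (V₁.directSum V₂) (opSum A₁ A₂) =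
      opSum (outerDaseinisation V₁ A₁) (outerDaseinisation V₂ A₂) := by
  obtain ⟨h₁, h₂⟩ := isSelfAdjoint_opSum_iff.1 hA
  have i₁ := isSpectralIntegral_outerDaseinisation V₁ h₁
  have i₂ := isSpectralIntegral_outerDaseinisation V₂ h₂
  have i := isSpectralIntegral_outerDaseinisation (V₁.directSum V₂) hA
  -- It remains to see that the block sum is also an integral of the daseinised family of `A₁ ⊕ A₂`.
  refine ⟨⟨i₁, i₂, i⟩, i.unique ?_⟩
  have hF : daseinisedFamily (V₁.directSum V₂) (opSum A₁ A₂) =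
      fun r => opSum (daseinisedFamily V₁ A₁ r) (daseinisedFamily V₂ A₂ r) := by
    funext r
    simp only [daseinisedFamily]
    rw [spectralFamily_opSum h₁ h₂]
    exact innerDaseinisation_directSum V₁ V₂ (isStarProjection_spectralFamily A₁ r)
      (isStarProjection_spectralFamily A₂ r)
  rw [hF]
  exact isSpectralIntegral_opSum i₁ i₂
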